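/- Let $\Omega\subset\mathbb{R}^d$ be a bounded Lipschitz domain, $s\in(0,1)$ with $s\neq\frac12$, and $\alpha,\beta>0$. Let $W$ be one of the following three real Hilbert spaces, which consist of the same functions on $\Omega$ and have equivalent norms: (a) $W=H_0^s(\Omega)$, the closure of $C_c^\infty(\Omega)$ in $H^s(\Omega)$, with the inner product of $H^s(\Omega)$, where for $U\subseteq\mathbb{R}^d$ open $$(u,w)_{H^s(U)}=\int_U uw\,dx+\frac{c_{d,s}}{2}\int_U\int_U\frac{(u(x)-u(y))(w(x)-w(y))}{|x-y|^{d+2s}}\,dy\,dx,\qquad c_{d,s}=\frac{s2^{2s}\Gamma(s+\frac d2)}{\pi^{d/2}\Gamma(1-s)},$$ and $H^s(U)$ is the space of all $w\in L^2(U)$ with $\frac{|w(x)-w(y)|}{|x-y|^{d/2+s}}\in L^2(U\times U)$; (b) $W=\tilde H^s(\Omega)=\{w\in H^s(\mathbb{R}^d): w=0 \text{ a.e. in } \mathbb{R}^d\setminus\Omega\}$, with the inner product of $H^s(\mathbb{R}^d)$; (c) $W=\mathbb{H}^s(\Omega)=\{w=\sum_n w_n\phi_n\in L^2(\Omega): \sum_n\lambda_n^s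 w_n^2<\infty\}$, $w_n=\int_\Omega w\phi_n\,dx$, with the inner product $\sum_n\lambda_n^s u_nw_n$, where $(\phi_n)$ is an $L^2(\Omega)$-orthonormal basis of eigenfunctions of the Laplacian with zero Dirichlet boundary conditions, with eigenvalues $\lambda_n$. Let $F\colon W\to\mathbb{R}$ be weakly lower semicontinuous, continuously Fréchet differentiable, and bounded from below by an affine function, i.e. there are $g\in W^*$ and $c\in\mathbb{R}$ with $F(w)\ge g(w)+c$ for all $w\in W$. Let $\bar w_0\in W$ be a local solution (a local minimizer with respect to the norm of $W$) of $$\min_{w\in W}\ F(w)+\frac{\alpha}{2}\|w\|_W^2+\beta\,|\{x\in\Omega: w(x)\neq0\}|,$$ where $|\cdot|$ is Lebesgue measure. Then there is exactly one $\bar\lambda_0\in W^*$ with $$\alpha(\bar w_0,v)_W+\beta\langle\bar\lambda_0,v\rangle_W=-\langle F'(\bar w_0),v\rangle_W\qquad\forall v\in W,$$ and it satisfies $$\langle\bar\lambda_0,\bar w_0\rangle_W=0.$$ -/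

import Mathlib

open MeasureTheory Filter Topology
open scoped ContDiff NNReal

noncomputable section

namespace FracSparse

/-- Euclidean space `ℝ^d`. -/
abbrev E (d : ℕ) : Type := EuclideanSpace ℝ (Fin d)

/-- `L²(U)` for `U ⊆ ℝ^d`, with Lebesgue measure. -/
abbrev L2 {d : ℕ} (U : Set (E d)) : Type := Lp ℝ 2 (volume.restrict U)

/-- `Ω` is a bounded Lipschitz domain: bounded, open, connected, and near every boundary point `Ω`
is, in suitable orthonormal coordinates, the strict epigraph of a Lipschitz function. The unit
vector `e` is the direction of the last coordinate, the hyperplane `e^⊥` carries the others. -/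
structure IsBoundedLipschitzDomain {d : ℕ} (Ω : Set (E d)) : Prop where
  isOpen : IsOpen Ω
  isConnected : IsConnected Ω
  isBounded : Bornology.IsBounded Ω
  lipschitz_boundary : ∀ x ∈ frontier Ω, ∃ e : E d, ‖e‖ = 1 ∧
    ∃ (K : ℝ≥0) (g : (Submodule.span ℝ {e})ᗮ → ℝ), LipschitzWith K g ∧
      ∃ r : ℝ, 0 < r ∧ ∀ y ∈ Metric.ball x r,
        (y ∈ Ω ↔ g ((Submodule.span ℝ {e})ᗮ.orthogonalProjectionOnto y) < inner ℝ e y)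

/-- `f ∈ C_c^∞(Ω)`. -/
structure IsTestFunction {d : ℕ} (Ω : Set (E d)) (f : E d → ℝ) : Prop where
  smooth : ContDiff ℝ ∞ f
  compact : HasCompactSupport f
  support : tsupport f ⊆ Ω

theorem IsTestFunction.zero {d : ℕ} (Ω : Set (E d)) : IsTestFunction Ω (0 : E d → ℝ) where
  smooth := contDiff_const
  compact := HasCompactSupport.zero
  support := by simp [tsupport]

theorem IsTestFunction.add {d : ℕ} {Ω : Set (E d)} {f g : E d → ℝ}
    (hf : IsTestFunction Ω f) (hg : IsTestFunction Ω g) : IsTestFunction Ω (f + g) where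
  smooth := hf.smooth.add hg.smooth
  compact := hf.compact.add hg.compact
  support := (tsupport_add f g).trans (Set.union_subset hf.support hg.support)

theorem IsTestFunction.smul {d : ℕ} {Ω : Set (E d)} {f : E d → ℝ}
    (hf : IsTestFunction Ω f) (c : ℝ) : IsTestFunction Ω (c • f) where
  smooth := hf.smooth.const_smul c
  compact := hf.compact.smul_left (f := fun _ => c)
  support := (tsupport_smul_subset_right (fun _ => c) f).trans hf.support

/-! ### The spaces `H^s(U)`, `H_0^s(Ω)` and `H̃^s(Ω)` -/

/-- The constant `c_{d,s} = s 2^{2s} Γ(s + d/2) / (π^{d/2} Γ(1 - s))`. -/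
def cConst (d : ℕ) (s : ℝ) : ℝ :=
  s * 2 ^ (2 * s) * Real.Gamma (s + d / 2) / (Real.pi ^ ((d : ℝ) / 2) * Real.Gamma (1 - s))

theorem cConst_nonneg (d : ℕ) (s : Set.Ioo (0 : ℝ) 1) : 0 ≤ cConst d s := by
  obtain ⟨s, h0, h1⟩ := s
  have g1 : 0 < Real.Gamma (s + d / 2) := Real.Gamma_pos_of_pos (by positivity)
  have g2 : 0 < Real.Gamma (1 - s) := Real.Gamma_pos_of_pos (by linarith)
  unfold cConst
  positivity

/-- The difference quotient `(w(x) - w(y)) / |x - y|^{d/2 + s}` as a function of `(x, y)`. -/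
def diffQuot {d : ℕ} (s : ℝ) (w : E d → ℝ) (p : E d × E d) : ℝ :=
  (w p.1 - w p.2) / ‖p.1 - p.2‖ ^ ((d : ℝ) / 2 + s)

/-- Lebesgue measure on `U × U`. -/
abbrev vol2 {d : ℕ} (U : Set (E d)) : Measure (E d × E d) :=
  (volume.restrict U).prod (volume.restrict U)

theorem diffQuot_congr {d : ℕ} {U : Set (E d)} (s : ℝ) {v w : E d → ℝ}
    (h : v =ᵐ[volume.restrict U] w) : diffQuot s v =ᵐ[vol2 U] diffQuot s w := by
  filter_upwards [Measure.quasiMeasurePreserving_fst.ae_eq_comp h,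
    Measure.quasiMeasurePreserving_snd.ae_eq_comp h] with p h1 h2
  simp only [Function.comp_apply] at h1 h2
  simp only [diffQuot, h1, h2]

theorem diffQuot_add {d : ℕ} (s : ℝ) (v w : E d → ℝ) :
    diffQuot s (v + w) = diffQuot s v + diffQuot s w := by
  funext p
  simp only [diffQuot, Pi.add_apply]
  ring

theorem diffQuot_smul {d : ℕ} (s c : ℝ) (w : E d → ℝ) :
    diffQuot s (c • w) = c • diffQuot s w := by
  funext p
  simp only [diffQuot, Pi.smul_apply, smul_eq_mul]
  ring

theorem diffQuot_coe_add {d : ℕ} {U : Set (E d)} (s : ℝ) (v w : L2 U) :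
    diffQuot s ⇑(v + w) =ᵐ[vol2 U] diffQuot s v + diffQuot s w := by
  rw [← diffQuot_add]
  exact diffQuot_congr s (Lp.coeFn_add v w)

theorem diffQuot_coe_smul {d : ℕ} {U : Set (E d)} (s c : ℝ) (w : L2 U) :
    diffQuot s ⇑(c • w) =ᵐ[vol2 U] c • diffQuot s w := by
  rw [← diffQuot_smul]
  exact diffQuot_congr s (Lp.coeFn_smul c w)

/-- The functions `w ∈ L²(U)` whose difference quotient is in `L²(U × U)`. -/
def hsSubmodule {d : ℕ} (U : Set (E d)) (s : Set.Ioo (0 : ℝ) 1) : Submodule ℝ (L2 U) where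
  carrier := {w | MemLp (diffQuot s w) 2 (vol2 U)}
  zero_mem' := by
    have h : diffQuot (d := d) s ⇑(0 : L2 U) =ᵐ[vol2 U] (0 : E d × E d → ℝ) := by
      refine (diffQuot_congr s (Lp.coeFn_zero ℝ 2 (volume.restrict U))).trans ?_
      exact Eventually.of_forall fun p => by simp [diffQuot]
    exact (memLp_congr_ae h).2 MemLp.zero
  add_mem' := fun {v w} hv hw => (memLp_congr_ae (diffQuot_coe_add s v w)).2 (hv.add hw)
  smul_mem' := fun c w hw => (memLp_congr_ae (diffQuot_coe_smul s c w)).2 (hw.const_smul c)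

/-- The fractional Sobolev space `H^s(U)`. It is a type of its own, because it carries the norm
below and not the norm of `L²(U)`. -/
def Hs {d : ℕ} (U : Set (E d)) (s : Set.Ioo (0 : ℝ) 1) : Type := hsSubmodule U s

instance {d : ℕ} (U : Set (E d)) (s : Set.Ioo (0 : ℝ) 1) : AddCommGroup (Hs U s) :=
  inferInstanceAs (AddCommGroup (hsSubmodule U s))

instance {d : ℕ} (U : Set (E d)) (s : Set.Ioo (0 : ℝ) 1) : Module ℝ (Hs U s) :=
  inferInstanceAs (Module ℝ (hsSubmodule U s))

/-- The inclusion `H^s(U) → L²(U)`. -/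
def Hs.toL2 {d : ℕ} {U : Set (E d)} {s : Set.Ioo (0 : ℝ) 1} : Hs U s →ₗ[ℝ] L2 U :=
  (hsSubmodule U s).subtype

theorem Hs.toL2_add {d : ℕ} {U : Set (E d)} {s : Set.Ioo (0 : ℝ) 1} (u v : Hs U s) :
    (u + v).toL2 = u.toL2 + v.toL2 := rfl

theorem Hs.toL2_smul {d : ℕ} {U : Set (E d)} {s : Set.Ioo (0 : ℝ) 1} (r : ℝ) (u : Hs U s) :
    (r • u).toL2 = r • u.toL2 := rfl

theorem Hs.memLp_diffQuot {d : ℕ} {U : Set (E d)} {s : Set.Ioo (0 : ℝ) 1} (w : Hs U s) :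
    MemLp (diffQuot s w.toL2) 2 (vol2 U) := Subtype.property w

/-- The inner product of `H^s(U)`:
`∫_U u w dx + (c_{d,s}/2) ∫_U ∫_U (u(x)-u(y)) (w(x)-w(y)) / |x-y|^{d+2s} dy dx`. -/
def Hs.innerProd {d : ℕ} {U : Set (E d)} {s : Set.Ioo (0 : ℝ) 1} (u w : Hs U s) : ℝ :=
  (∫ x in U, u.toL2 x * w.toL2 x) +
    cConst d s / 2 * ∫ p, diffQuot s u.toL2 p * diffQuot s w.toL2 p ∂(vol2 U)

theorem Hs.innerProd_eq {d : ℕ} {U : Set (E d)} {s : Set.Ioo (0 : ℝ) 1} (u w : Hs U s) :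
    u.innerProd w = inner ℝ u.toL2 w.toL2 +
      cConst d s / 2 * ∫ p, diffQuot s u.toL2 p * diffQuot s w.toL2 p ∂(vol2 U) := by
  rw [Hs.innerProd, L2.inner_def]
  simp [mul_comm]

theorem Hs.integral_nonneg {d : ℕ} {U : Set (E d)} {s : Set.Ioo (0 : ℝ) 1} (u : Hs U s) :
    0 ≤ ∫ p, diffQuot s u.toL2 p * diffQuot s u.toL2 p ∂(vol2 U) :=
  MeasureTheory.integral_nonneg fun _ => mul_self_nonneg _

theorem Hs.integrable_mul {d : ℕ} {U : Set (E d)} {s : Set.Ioo (0 : ℝ) 1} (u w : Hs U s) :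
    Integrable (fun p => diffQuot s u.toL2 p * diffQuot s w.toL2 p) (vol2 U) :=
  MemLp.integrable_mul (p := 2) (q := 2) u.memLp_diffQuot w.memLp_diffQuot

theorem Hs.integral_add {d : ℕ} {U : Set (E d)} {s : Set.Ioo (0 : ℝ) 1} (u v w : Hs U s) :
    ∫ p, diffQuot s (Hs.toL2 u + Hs.toL2 v) p * diffQuot s w.toL2 p ∂(vol2 U) =
      (∫ p, diffQuot s u.toL2 p * diffQuot s w.toL2 p ∂(vol2 U)) +
        ∫ p, diffQuot s v.toL2 p * diffQuot s w.toL2 p ∂(vol2 U) := by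
  rw [← MeasureTheory.integral_add (u.integrable_mul w) (v.integrable_mul w)]
  refine integral_congr_ae ?_
  filter_upwards [diffQuot_coe_add s u.toL2 v.toL2] with p hp
  rw [hp, Pi.add_apply, add_mul]

theorem Hs.integral_smul {d : ℕ} {U : Set (E d)} {s : Set.Ioo (0 : ℝ) 1} (r : ℝ)
    (u w : Hs U s) :
    ∫ p, diffQuot s (r • Hs.toL2 u) p * diffQuot s w.toL2 p ∂(vol2 U) =
      r * ∫ p, diffQuot s u.toL2 p * diffQuot s w.toL2 p ∂(vol2 U) := by
  rw [← integral_const_mul]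
  refine integral_congr_ae ?_
  filter_upwards [diffQuot_coe_smul s r u.toL2] with p hp
  rw [hp, Pi.smul_apply, smul_eq_mul, mul_assoc]

theorem Hs.innerProd_add_left {d : ℕ} {U : Set (E d)} {s : Set.Ioo (0 : ℝ) 1} (u v w : Hs U s) :
    (u + v).innerProd w = u.innerProd w + v.innerProd w := by
  rw [Hs.innerProd_eq, Hs.innerProd_eq, Hs.innerProd_eq, Hs.toL2_add, Hs.integral_add,
    inner_add_left]
  ring

theorem Hs.innerProd_smul_left {d : ℕ} {U : Set (E d)} {s : Set.Ioo (0 : ℝ) 1} (r : ℝ)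
    (u w : Hs U s) : (r • u).innerProd w = r * u.innerProd w := by
  rw [Hs.innerProd_eq, Hs.innerProd_eq, Hs.toL2_smul, Hs.integral_smul,
    real_inner_smul_left u.toL2 w.toL2 r]
  ring

theorem Hs.le_innerProd_self {d : ℕ} {U : Set (E d)} {s : Set.Ioo (0 : ℝ) 1} (u : Hs U s) :
    inner ℝ u.toL2 u.toL2 ≤ u.innerProd u := by
  rw [Hs.innerProd_eq]
  exact le_add_of_nonneg_right
    (mul_nonneg (div_nonneg (cConst_nonneg d s) zero_le_two) u.integral_nonneg)

theorem Hs.innerProd_definite {d : ℕ} {U : Set (E d)} {s : Set.Ioo (0 : ℝ) 1} (u : Hs U s)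
    (hu : u.innerProd u = 0) : u = 0 := by
  have h : inner ℝ u.toL2 u.toL2 = 0 :=
    le_antisymm (hu ▸ u.le_innerProd_self) real_inner_self_nonneg
  have h2 : u.toL2 = 0 := inner_self_eq_zero.1 h
  exact Subtype.ext h2

/-- `Hs.innerProd` is an inner product. -/
@[reducible]
def Hs.core {d : ℕ} (U : Set (E d)) (s : Set.Ioo (0 : ℝ) 1) :
    InnerProductSpace.Core ℝ (Hs U s) where
  inner u w := u.innerProd w
  conj_inner_symm u w := by simp [Hs.innerProd, mul_comm]
  re_inner_nonneg u := le_trans real_inner_self_nonneg u.le_innerProd_self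
  add_left := Hs.innerProd_add_left
  smul_left u w r := Hs.innerProd_smul_left r u w
  definite := Hs.innerProd_definite

instance {d : ℕ} (U : Set (E d)) (s : Set.Ioo (0 : ℝ) 1) : NormedAddCommGroup (Hs U s) :=
  (Hs.core U s).toNormedAddCommGroup

instance {d : ℕ} (U : Set (E d)) (s : Set.Ioo (0 : ℝ) 1) : InnerProductSpace ℝ (Hs U s) :=
  InnerProductSpace.ofCore (Hs.core U s).toCore

/-- `C_c^∞(Ω)` as a subspace of `H^s(Ω)`. -/
def testHs {d : ℕ} (Ω : Set (E d)) (s : Set.Ioo (0 : ℝ) 1) : Submodule ℝ (Hs Ω s) where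
  carrier := {w | ∃ f, IsTestFunction Ω f ∧ w.toL2 =ᵐ[volume.restrict Ω] f}
  zero_mem' := ⟨0, IsTestFunction.zero Ω, by rw [map_zero]; exact Lp.coeFn_zero _ _ _⟩
  add_mem' := by
    rintro v w ⟨f, hf, hvf⟩ ⟨g, hg, hwg⟩
    refine ⟨f + g, hf.add hg, ?_⟩
    rw [map_add]
    exact (Lp.coeFn_add _ _).trans (hvf.add hwg)
  smul_mem' := by
    rintro c w ⟨f, hf, hwf⟩
    refine ⟨c • f, hf.smul c, ?_⟩
    rw [map_smul]
    exact (Lp.coeFn_smul _ _).trans (hwf.const_smul c)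

/-- `H_0^s(Ω)`, the closure of `C_c^∞(Ω)` in `H^s(Ω)`, with the inner product of `H^s(Ω)`. -/
abbrev H0s {d : ℕ} (Ω : Set (E d)) (s : Set.Ioo (0 : ℝ) 1) : Submodule ℝ (Hs Ω s) :=
  (testHs Ω s).topologicalClosure

/-- `H̃^s(Ω)`, the functions in `H^s(ℝ^d)` that vanish almost everywhere outside `Ω`, with the
inner product of `H^s(ℝ^d)`. -/
def tildeHs {d : ℕ} (Ω : Set (E d)) (s : Set.Ioo (0 : ℝ) 1) :
    Submodule ℝ (Hs (Set.univ : Set (E d)) s) where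
  carrier := {w | ∀ᵐ x ∂(volume : Measure (E d)), x ∉ Ω → w.toL2 x = 0}
  zero_mem' := by
    have h : ⇑(0 : L2 (Set.univ : Set (E d))) =ᵐ[volume.restrict Set.univ] 0 :=
      Lp.coeFn_zero ℝ 2 (volume.restrict (Set.univ : Set (E d)))
    rw [Filter.EventuallyEq, congrArg ae Measure.restrict_univ] at h
    simp only [Set.mem_ofPred_eq, map_zero]
    filter_upwards [h] with x hx _
    exact hx
  add_mem' := by
    intro v w hv hw
    have h := Lp.coeFn_add v.toL2 w.toL2
    simp only [Measure.restrict_univ] at h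
    simp only [Set.mem_ofPred_eq, map_add] at hv hw ⊢
    filter_upwards [h, hv, hw] with x hx h1 h2 hxΩ
    rw [hx, Pi.add_apply, h1 hxΩ, h2 hxΩ, add_zero]
  smul_mem' := by
    intro c w hw
    have h := Lp.coeFn_smul c w.toL2
    simp only [Measure.restrict_univ] at h
    simp only [Set.mem_ofPred_eq, map_smul] at hw ⊢
    filter_upwards [h, hw] with x hx h1 hxΩ
    rw [hx, Pi.smul_apply, h1 hxΩ, smul_zero]

/-! ### The Dirichlet Laplacian and the spectral space `ℍ^s(Ω)` -/

theorem gradient_test_add {d : ℕ} {Ω : Set (E d)} {f g : E d → ℝ}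
    (hf : IsTestFunction Ω f) (hg : IsTestFunction Ω g) :
    gradient (f + g) = gradient f + gradient g := by
  funext x
  have h1 : DifferentiableAt ℝ f x := hf.smooth.differentiable (by simp) x
  have h2 : DifferentiableAt ℝ g x := hg.smooth.differentiable (by simp) x
  simp only [gradient, Pi.add_apply, fderiv_add h1 h2, map_add]

theorem gradient_test_smul {d : ℕ} {Ω : Set (E d)} {f : E d → ℝ}
    (hf : IsTestFunction Ω f) (c : ℝ) : gradient (c • f) = c • gradient f := by
  funext x
  have h1 : DifferentiableAt ℝ f x := hf.smooth.differentiable (by simp) x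
  simp only [gradient, Pi.smul_apply, fderiv_const_smul h1, map_smulₛₗ, conj_trivial]

/-- The pairs `(φ, ∇φ)` with `φ ∈ C_c^∞(Ω)`, in `L²(Ω) × L²(Ω; ℝ^d)`. -/
def testGraph {d : ℕ} (Ω : Set (E d)) :
    Submodule ℝ (L2 Ω × Lp (E d) 2 (volume.restrict Ω)) where
  carrier := {p | ∃ f, IsTestFunction Ω f ∧ p.1 =ᵐ[volume.restrict Ω] f ∧
    p.2 =ᵐ[volume.restrict Ω] gradient f}
  zero_mem' := by
    refine ⟨0, IsTestFunction.zero Ω, Lp.coeFn_zero _ _ _, ?_⟩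
    have h : gradient (0 : E d → ℝ) = 0 := by
      funext x
      simp [gradient]
    rw [h]
    exact Lp.coeFn_zero _ _ _
  add_mem' := by
    rintro p q ⟨f, hf, h1, h2⟩ ⟨g, hg, h3, h4⟩
    refine ⟨f + g, hf.add hg, (Lp.coeFn_add _ _).trans (h1.add h3), ?_⟩
    rw [gradient_test_add hf hg]
    exact (Lp.coeFn_add _ _).trans (h2.add h4)
  smul_mem' := by
    rintro c p ⟨f, hf, h1, h2⟩
    refine ⟨c • f, hf.smul c, (Lp.coeFn_smul _ _).trans (h1.const_smul c), ?_⟩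
    rw [gradient_test_smul hf c]
    exact (Lp.coeFn_smul _ _).trans (h2.const_smul c)

/-- The pairs `(u, ∇u)` with `u ∈ H_0^1(Ω)`, the closure of `C_c^∞(Ω)` in the `H^1`-norm. -/
def h01Graph {d : ℕ} (Ω : Set (E d)) : Submodule ℝ (L2 Ω × Lp (E d) 2 (volume.restrict Ω)) :=
  (testGraph Ω).topologicalClosure

/-- The eigenspace of the Dirichlet Laplacian on `Ω` for the value `μ`: the `u ∈ H_0^1(Ω)` with
`∫_Ω ∇u · ∇v dx = μ ∫_Ω u v dx` for all `v ∈ H_0^1(Ω)`. -/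
def eigenspace {d : ℕ} (Ω : Set (E d)) (μ : ℝ) : Submodule ℝ (L2 Ω) where
  carrier := {u | ∃ g, (u, g) ∈ h01Graph Ω ∧
    ∀ v h, (v, h) ∈ h01Graph Ω → inner ℝ g h = μ * inner ℝ u v}
  zero_mem' := ⟨0, (h01Graph Ω).zero_mem, fun v h _ => by simp⟩
  add_mem' := by
    rintro u₁ u₂ ⟨g₁, h₁, e₁⟩ ⟨g₂, h₂, e₂⟩
    refine ⟨g₁ + g₂, (h01Graph Ω).add_mem h₁ h₂, fun v h hv => ?_⟩
    rw [inner_add_left, inner_add_left, e₁ v h hv, e₂ v h hv, mul_add]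
  smul_mem' := by
    rintro c u ⟨g, h, e⟩
    refine ⟨c • g, (h01Graph Ω).smul_mem c h, fun v k hv => ?_⟩
    rw [real_inner_smul_left, real_inner_smul_left, e v k hv]
    ring

/-- The orthogonal projection of `L²(Ω)` onto the eigenspace for `μ`: it maps `w` to the sum of
`(∫_Ω w φ_n dx) φ_n` over the members `φ_n` with eigenvalue `μ` of an orthonormal system of
eigenfunctions (it is zero if `μ` is not an eigenvalue). Eigenspaces are closed; the closure only
serves to have the projection at hand without a proof of that. -/
def eigenProj {d : ℕ} (Ω : Set (E d)) (μ : ℝ) : L2 Ω →L[ℝ] L2 Ω :=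
  (eigenspace Ω μ).topologicalClosure.starProjection

/-- The functions `w ∈ L²(Ω)` that equal their expansion in Dirichlet eigenfunctions and satisfy
`∑ λ_n^s w_n² < ∞`, with `w_n = ∫_Ω w φ_n dx`. The sum is arranged by eigenvalues: the terms with
`λ_n = μ` add up to `μ^s ‖P_μ w‖²`. All Dirichlet eigenvalues are positive. -/
def spectralSubmodule {d : ℕ} (Ω : Set (E d)) (s : Set.Ioo (0 : ℝ) 1) : Submodule ℝ (L2 Ω) where
  carrier := {w | HasSum (fun μ : Set.Ioi (0 : ℝ) => eigenProj Ω μ w) w ∧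
    Summable fun μ : Set.Ioi (0 : ℝ) => (μ : ℝ) ^ (s : ℝ) * ‖eigenProj Ω μ w‖ ^ 2}
  zero_mem' := by simp [hasSum_zero, summable_zero]
  add_mem' := by
    rintro v w ⟨hv, hv'⟩ ⟨hw, hw'⟩
    refine ⟨by simpa only [map_add] using hv.add hw, ?_⟩
    refine Summable.of_nonneg_of_le (fun μ => ?_) (fun μ => ?_) ((hv'.add hw').mul_left 2)
    · exact mul_nonneg (Real.rpow_nonneg (le_of_lt μ.2) _) (sq_nonneg _)
    · have h0 : (0 : ℝ) ≤ (μ : ℝ) ^ (s : ℝ) := Real.rpow_nonneg (le_of_lt μ.2) _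
      have h1 := norm_add_le (eigenProj Ω μ v) (eigenProj Ω μ w)
      have h2 : ‖eigenProj Ω μ v + eigenProj Ω μ w‖ ^ 2 ≤
          2 * (‖eigenProj Ω μ v‖ ^ 2 + ‖eigenProj Ω μ w‖ ^ 2) := by
        nlinarith [norm_nonneg (eigenProj Ω μ v + eigenProj Ω μ w),
          sq_nonneg (‖eigenProj Ω μ v‖ - ‖eigenProj Ω μ w‖)]
      rw [map_add]
      nlinarith [mul_le_mul_of_nonneg_left h2 h0]
  smul_mem' := by
    rintro c w ⟨hw, hw'⟩
    refine ⟨by simpa only [map_smul] using hw.const_smul c, ?_⟩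
    refine (hw'.mul_left (c ^ 2)).congr fun μ => ?_
    rw [map_smul, norm_smul, mul_pow, Real.norm_eq_abs, sq_abs]
    ring

/-- The spectral fractional Sobolev space `ℍ^s(Ω)`; a type of its own, because it carries the norm
below and not the norm of `L²(Ω)`. -/
def SpectralHs {d : ℕ} (Ω : Set (E d)) (s : Set.Ioo (0 : ℝ) 1) : Type := spectralSubmodule Ω s

instance {d : ℕ} (Ω : Set (E d)) (s : Set.Ioo (0 : ℝ) 1) : AddCommGroup (SpectralHs Ω s) :=
  inferInstanceAs (AddCommGroup (spectralSubmodule Ω s))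

instance {d : ℕ} (Ω : Set (E d)) (s : Set.Ioo (0 : ℝ) 1) : Module ℝ (SpectralHs Ω s) :=
  inferInstanceAs (Module ℝ (spectralSubmodule Ω s))

/-- The inclusion `ℍ^s(Ω) → L²(Ω)`. -/
def SpectralHs.toL2 {d : ℕ} {Ω : Set (E d)} {s : Set.Ioo (0 : ℝ) 1} :
    SpectralHs Ω s →ₗ[ℝ] L2 Ω :=
  (spectralSubmodule Ω s).subtype

/-- The inner product `∑ λ_n^s u_n w_n` of `ℍ^s(Ω)`, arranged by eigenvalues. -/
def SpectralHs.innerProd {d : ℕ} {Ω : Set (E d)} {s : Set.Ioo (0 : ℝ) 1}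
    (u w : SpectralHs Ω s) : ℝ :=
  ∑' μ : Set.Ioi (0 : ℝ),
    (μ : ℝ) ^ (s : ℝ) * inner ℝ (eigenProj Ω μ u.toL2) (eigenProj Ω μ w.toL2)

theorem SpectralHs.hasSum {d : ℕ} {Ω : Set (E d)} {s : Set.Ioo (0 : ℝ) 1}
    (w : SpectralHs Ω s) :
    HasSum (fun μ : Set.Ioi (0 : ℝ) => eigenProj Ω μ w.toL2) w.toL2 := (Subtype.property w).1

theorem SpectralHs.summable_sq {d : ℕ} {Ω : Set (E d)} {s : Set.Ioo (0 : ℝ) 1}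
    (w : SpectralHs Ω s) :
    Summable fun μ : Set.Ioi (0 : ℝ) => (μ : ℝ) ^ (s : ℝ) * ‖eigenProj Ω μ w.toL2‖ ^ 2 :=
  (Subtype.property w).2

theorem SpectralHs.summable_inner {d : ℕ} {Ω : Set (E d)} {s : Set.Ioo (0 : ℝ) 1}
    (u w : SpectralHs Ω s) : Summable fun μ : Set.Ioi (0 : ℝ) =>
      (μ : ℝ) ^ (s : ℝ) * inner ℝ (eigenProj Ω μ u.toL2) (eigenProj Ω μ w.toL2) := by
  refine Summable.of_norm_bounded (u.summable_sq.add w.summable_sq) fun μ => ?_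
  have h0 : (0 : ℝ) ≤ (μ : ℝ) ^ (s : ℝ) := Real.rpow_nonneg (le_of_lt μ.2) _
  have h1 := abs_real_inner_le_norm (eigenProj Ω μ u.toL2) (eigenProj Ω μ w.toL2)
  rw [Real.norm_eq_abs, abs_mul, abs_of_nonneg h0, ← mul_add]
  refine mul_le_mul_of_nonneg_left (h1.trans ?_) h0
  nlinarith [sq_nonneg (‖eigenProj Ω μ u.toL2‖ - ‖eigenProj Ω μ w.toL2‖),
    sq_nonneg ‖eigenProj Ω μ u.toL2‖, sq_nonneg ‖eigenProj Ω μ w.toL2‖]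

/-- `SpectralHs.innerProd` is an inner product. -/
@[reducible]
def SpectralHs.core {d : ℕ} (Ω : Set (E d)) (s : Set.Ioo (0 : ℝ) 1) :
    InnerProductSpace.Core ℝ (SpectralHs Ω s) where
  inner u w := u.innerProd w
  conj_inner_symm u w := by simp [SpectralHs.innerProd, real_inner_comm]
  re_inner_nonneg u := by
    refine tsum_nonneg fun μ => mul_nonneg (Real.rpow_nonneg (le_of_lt μ.2) _) real_inner_self_nonneg
  add_left u v w := by
    rw [SpectralHs.innerProd, SpectralHs.innerProd, SpectralHs.innerProd,
      ← (u.summable_inner w).tsum_add (v.summable_inner w)]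
    simp only [map_add, inner_add_left, mul_add]
  smul_left u w r := by
    simp only [SpectralHs.innerProd, map_smul, real_inner_smul_left, conj_trivial,
      ← tsum_mul_left]
    exact tsum_congr fun μ => by ring
  definite u hu := by
    have hnn : ∀ μ : Set.Ioi (0 : ℝ), 0 ≤ (μ : ℝ) ^ (s : ℝ) *
        inner ℝ (eigenProj Ω μ u.toL2) (eigenProj Ω μ u.toL2) := fun μ =>
      mul_nonneg (Real.rpow_nonneg (le_of_lt μ.2) _) real_inner_self_nonneg
    have h0 := (hasSum_zero_iff_of_nonneg hnn).1 (by
      have := (u.summable_inner u).hasSum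
      rwa [show ∑' μ : Set.Ioi (0 : ℝ), (μ : ℝ) ^ (s : ℝ) *
        inner ℝ (eigenProj Ω μ u.toL2) (eigenProj Ω μ u.toL2) = 0 from hu] at this)
    have h1 : ∀ μ : Set.Ioi (0 : ℝ), eigenProj Ω μ u.toL2 = 0 := fun μ => by
      have h2 := congrFun h0 μ
      rcases mul_eq_zero.1 h2 with h3 | h3
      · exact absurd h3 (Real.rpow_pos_of_pos μ.2 _).ne'
      · exact inner_self_eq_zero.1 h3
    have h2 := u.hasSum
    simp only [h1] at h2
    exact Subtype.ext (h2.unique hasSum_zero)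

instance {d : ℕ} (Ω : Set (E d)) (s : Set.Ioo (0 : ℝ) 1) :
    NormedAddCommGroup (SpectralHs Ω s) :=
  (SpectralHs.core Ω s).toNormedAddCommGroup

instance {d : ℕ} (Ω : Set (E d)) (s : Set.Ioo (0 : ℝ) 1) :
    InnerProductSpace ℝ (SpectralHs Ω s) :=
  InnerProductSpace.ofCore (SpectralHs.core Ω s).toCore

/-! ### The space `W` and the optimization problem -/

/-- The three choices of the inner product on `W`. -/
inductive Variant
  | restricted
  | extended
  | spectral

/-- The space `W`: for `s ∈ (0,1)`, `s ≠ 1/2`, the spaces `H_0^s(Ω)`, `H̃^s(Ω)` and `ℍ^s(Ω)` have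
the same elements (up to extension by zero) and equivalent norms, but different inner products.
For `s < 1/2` the space `H^s(Ω)` coincides with `H_0^s(Ω)` as well, with the same inner product. -/
def W {d : ℕ} (Ω : Set (E d)) (s : Set.Ioo (0 : ℝ) 1) : Variant → Type
  | .restricted => H0s Ω s
  | .extended => tildeHs Ω s
  | .spectral => SpectralHs Ω s

instance {d : ℕ} (Ω : Set (E d)) (s : Set.Ioo (0 : ℝ) 1) (k : Variant) :
    NormedAddCommGroup (W Ω s k) :=
  match k with
  | .restricted => inferInstanceAs (NormedAddCommGroup (H0s Ω s))
  | .extended => inferInstanceAs (NormedAddCommGroup (tildeHs Ω s))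
  | .spectral => inferInstanceAs (NormedAddCommGroup (SpectralHs Ω s))

instance {d : ℕ} (Ω : Set (E d)) (s : Set.Ioo (0 : ℝ) 1) (k : Variant) :
    InnerProductSpace ℝ (W Ω s k) :=
  match k with
  | .restricted => inferInstanceAs (InnerProductSpace ℝ (H0s Ω s))
  | .extended => inferInstanceAs (InnerProductSpace ℝ (tildeHs Ω s))
  | .spectral => inferInstanceAs (InnerProductSpace ℝ (SpectralHs Ω s))

/-- A representative of `w ∈ W`, a function that is determined almost everywhere on `Ω`. -/
def W.fn {d : ℕ} {Ω : Set (E d)} {s : Set.Ioo (0 : ℝ) 1} : {k : Variant} → W Ω s k → E d → ℝ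
  | .restricted => fun w => Hs.toL2 (Subtype.val (p := fun v => v ∈ H0s Ω s) w)
  | .extended => fun w => Hs.toL2 (Subtype.val (p := fun v => v ∈ tildeHs Ω s) w)
  | .spectral => fun w => SpectralHs.toL2 (Ω := Ω) (s := s) w

/-- `∫_Ω |w|^0 dx` with `0^0 = 0`, that is, the Lebesgue measure of `{x ∈ Ω : w(x) ≠ 0}`. -/
def W.l0 {d : ℕ} {Ω : Set (E d)} {s : Set.Ioo (0 : ℝ) 1} {k : Variant} (w : W Ω s k) : ℝ :=
  volume.real {x ∈ Ω | w.fn x ≠ 0}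

/-- The objective `F(w) + (α/2) ‖w‖_W² + β ∫_Ω |w|^0 dx`. -/
def objective {d : ℕ} {Ω : Set (E d)} {s : Set.Ioo (0 : ℝ) 1} {k : Variant}
    (F : W Ω s k → ℝ) (α β : ℝ) (w : W Ω s k) : ℝ :=
  F w + α / 2 * ‖w‖ ^ 2 + β * w.l0

/-- (Sequential) weak lower semicontinuity: if `u_n ⇀ u`, then `F(u) ≤ liminf F(u_n)`. -/
def WeaklyLSC {X : Type*} [NormedAddCommGroup X] [NormedSpace ℝ X] (F : X → ℝ) : Prop :=
  ∀ (u : ℕ → X) (x : X), (∀ l : StrongDual ℝ X, Tendsto (fun n => l (u n)) atTop (𝓝 (l x))) →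
    ∀ c < F x, ∀ᶠ n in atTop, c < F (u n)

/-- The assumptions on the smooth part `F` of the objective. -/
structure Admissible {X : Type*} [NormedAddCommGroup X] [NormedSpace ℝ X] (F : X → ℝ) : Prop where
  weaklyLSC : WeaklyLSC F
  bounded_below : ∃ (g : StrongDual ℝ X) (c : ℝ), ∀ w, g w + c ≤ F w
  contDiff : ContDiff ℝ 1 F

end FracSparse

end

/-! Multiplying `w` by a nonzero constant does not move the set where `w` vanishes, so near `w₀` the
discontinuous part of the objective is constant along the ray through `w₀`. On this ray a local
minimizer is therefore critical for the smooth part, that is, `F'(w₀) w₀ + α ‖w₀‖² = 0`. The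
multiplier is what the gradient equation leaves over, divided by `β`. -/

namespace FracSparse

section LocalMin

theorem hasLineDerivAt_eq_zero_of_isLocalMin_add {X : Type*} [AddCommGroup X] [Module ℝ X]
    [TopologicalSpace X] [ContinuousAdd X] [ContinuousSMul ℝ X] {G J : X → ℝ} {x v : X} {g : ℝ}
    (hmin : IsLocalMin (fun w => G w + J w) x)
    (hJ : ∀ᶠ t : ℝ in 𝓝 0, J (x + t • v) ≤ J x) (hG : HasLineDerivAt ℝ G g x v) : g = 0 := by
  have hline : Tendsto (fun t : ℝ => x + t • v) (𝓝 0) (𝓝 x) :=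
    Continuous.tendsto' (by fun_prop) _ _ (by simp)
  have hminG : IsMinFilter G (map (fun t : ℝ => x + t • v) (𝓝 0)) x := by
    refine eventually_map.2 ?_
    filter_upwards [hline.eventually hmin, hJ] with t hGJ hJt
    linarith
  exact hminG.isExtr.hasLineDerivAt_eq_zero hG tendsto_map

variable {H : Type*} [NormedAddCommGroup H] [InnerProductSpace ℝ H]

theorem inner_add_fderiv_self_eq_zero_of_isLocalMin {F J : H → ℝ} {α : ℝ} {w₀ : H}
    (hF : DifferentiableAt ℝ F w₀) (hJ : ∀ᶠ t : ℝ in 𝓝 1, J (t • w₀) ≤ J w₀)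
    (hw₀ : IsLocalMin (fun w => F w + α / 2 * ‖w‖ ^ 2 + J w) w₀) :
    α * inner ℝ w₀ w₀ + fderiv ℝ F w₀ w₀ = 0 := by
  have hsmooth : HasFDerivAt (fun w => F w + α / 2 * ‖w‖ ^ 2)
      (fderiv ℝ F w₀ + (α / 2) • (2 • innerSL ℝ w₀)) w₀ :=
    hF.hasFDerivAt.add ((hasStrictFDerivAt_norm_sq w₀).hasFDerivAt.const_mul (α / 2))
  have hshift : Tendsto (fun t : ℝ => 1 + t) (𝓝 0) (𝓝 1) :=
    Continuous.tendsto' (by fun_prop) _ _ (add_zero 1)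
  have hray : ∀ᶠ t : ℝ in 𝓝 0, J (w₀ + t • w₀) ≤ J w₀ := by
    simpa only [add_smul, one_smul] using hshift.eventually hJ
  calc α * inner ℝ w₀ w₀ + fderiv ℝ F w₀ w₀
      = (fderiv ℝ F w₀ + (α / 2) • (2 • innerSL ℝ w₀)) w₀ := by
        simp only [add_apply, smul_apply, innerSL_apply_apply, smul_eq_mul, nsmul_eq_mul]
        ring
    _ = 0 := hasLineDerivAt_eq_zero_of_isLocalMin_add hw₀ hray (hsmooth.hasLineDerivAt w₀)

theorem existsUnique_inner_add_mul_eq_neg {α β : ℝ} (hβ : β ≠ 0) (D : StrongDual ℝ H) (w : H) :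
    ∃! l : StrongDual ℝ H, ∀ v, α * inner ℝ w v + β * l v = -D v := by
  have hiff (l : StrongDual ℝ H) :
      (∀ v, α * inner ℝ w v + β * l v = -D v) ↔ β • l = -D - α • innerSL ℝ w := by
    simp only [eq_sub_iff_add_eq', ContinuousLinearMap.ext_iff, add_apply, smul_apply, neg_apply,
      innerSL_apply_apply, smul_eq_mul]
  simpa only [hiff] using (MulAction.bijective₀ hβ).existsUnique (-D - α • innerSL ℝ w)

end LocalMin

section Support

variable {d : ℕ} {Ω : Set (E d)} {s : Set.Ioo (0 : ℝ) 1} {k : Variant}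

theorem W.fn_smul_ae (c : ℝ) (w : W Ω s k) : (c • w).fn =ᵐ[volume.restrict Ω] c • w.fn := by
  cases k with
  | restricted => exact Lp.coeFn_smul c (Hs.toL2 (Subtype.val (p := (· ∈ H0s Ω s)) w))
  | extended =>
    exact ae_restrict_of_ae_restrict_of_subset (Set.subset_univ Ω)
      (Lp.coeFn_smul c (Hs.toL2 (Subtype.val (p := (· ∈ tildeHs Ω s)) w)))
  | spectral => exact Lp.coeFn_smul c (SpectralHs.toL2 (Ω := Ω) (s := s) w)

theorem W.l0_smul {c : ℝ} (hc : c ≠ 0) (w : W Ω s k) : (c • w).l0 = w.l0 := by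
  refine measureReal_congr (eventuallyEq_set.2 ?_)
  filter_upwards [ae_imp_of_ae_restrict (W.fn_smul_ae c w)] with x hx
  refine and_congr_right fun hxΩ => ?_
  rw [hx hxΩ, Pi.smul_apply, smul_ne_zero_iff_right hc]

end Support

end FracSparse

open FracSparse in
theorem mainTheorem7_general {H : Type*} [NormedAddCommGroup H] [InnerProductSpace ℝ H]
    {F J : H → ℝ} {α β : ℝ} (hβ : β ≠ 0) {w₀ : H} (hF : DifferentiableAt ℝ F w₀)
    (hJ : ∀ᶠ t : ℝ in 𝓝 1, J (t • w₀) = J w₀)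
    (hw₀ : IsLocalMin (fun w => F w + α / 2 * ‖w‖ ^ 2 + β * J w) w₀) :
    (∃! l₀ : StrongDual ℝ H, ∀ v : H, α * inner ℝ w₀ v + β * l₀ v = -(fderiv ℝ F w₀ v)) ∧
    ∀ l₀ : StrongDual ℝ H,
      (∀ v : H, α * inner ℝ w₀ v + β * l₀ v = -(fderiv ℝ F w₀ v)) → l₀ w₀ = 0 := by
  refine ⟨existsUnique_inner_add_mul_eq_neg hβ (fderiv ℝ F w₀) w₀, fun l₀ hl₀ => ?_⟩
  have hβJ : ∀ᶠ t : ℝ in 𝓝 1, β * J (t • w₀) ≤ β * J w₀ :=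
    hJ.mono fun t ht => (congrArg (β * ·) ht).le
  have hcrit : α * inner ℝ w₀ w₀ + fderiv ℝ F w₀ w₀ = 0 :=
    inner_add_fderiv_self_eq_zero_of_isLocalMin hF hβJ hw₀
  have hβl₀ : β * l₀ w₀ = 0 := by linarith [hl₀ w₀]
  exact (mul_eq_zero.1 hβl₀).resolve_left hβ

open FracSparse in
theorem mainTheorem7 {d : ℕ} (Ω : Set (E d)) (hΩ : IsBoundedLipschitzDomain Ω)
    (s : Set.Ioo (0 : ℝ) 1) (hs : (s : ℝ) ≠ 1 / 2) (k : Variant)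
    (α β : ℝ) (hα : 0 < α) (hβ : 0 < β)
    (F : W Ω s k → ℝ) (hF : Admissible F)
    (w₀ : W Ω s k) (hw₀ : IsLocalMin (objective F α β) w₀) :
    (∃! l₀ : StrongDual ℝ (W Ω s k),
      ∀ v : W Ω s k, α * inner ℝ w₀ v + β * l₀ v = -(fderiv ℝ F w₀ v)) ∧
    ∀ l₀ : StrongDual ℝ (W Ω s k),
      (∀ v : W Ω s k, α * inner ℝ w₀ v + β * l₀ v = -(fderiv ℝ F w₀ v)) → l₀ w₀ = 0 :=
  mainTheorem7_general hβ.ne' (hF.contDiff.differentiable one_ne_zero w₀)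
    ((eventually_ne_nhds one_ne_zero).mono fun _ ht => W.l0_smul ht w₀) hw₀
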